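/- For a group $G$ and a subset $S\subseteq G$, the Haar graph $H(G,S)$ is the simple graph with vertex set $G\times\{0,1\}$ whose edges are the pairs $\{(g,0),(sg,1)\}$ with $g\in G$ and $s\in S$. Let $n>7$, let $D_n=\langle a,b\mid a^n=b^2=1,\ bab=a^{-1}\rangle$ be the dihedral group of order $2n$, and let $S=\{1,a,a^3,b,ab,a^2b,a^4b\}\subset D_n$. Then the full automorphism group $\operatorname{Aut} H(D_n,S)$ is isomorphic to $D_n$. Moreover, $\operatorname{Aut} H(D_n,S)$ has exactly two orbits on the vertices of $H(D_n,S)$; hence $H(D_n,S)$ is not vertex-transitive, and it is not a Cayley graph, i.e. it is not isomorphic to any graph $\operatorname{Cay}(G,T)$ with vertex set a group $G$ and edges $\{g,tg\}$ for $g\in G$, $t\in T$, where $1\notin T=T^{-1}\subseteq G$. -/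

import Mathlib

universe w

/-- The Haar graph `H(G, S)`: its vertices are the pairs `(g, i)` with `g ∈ G` and `i ∈ {0, 1}`,
its edges are the pairs `{(g, 0), (s * g, 1)}` with `g ∈ G` and `s ∈ S`. -/
def haarGraph {G : Type*} [Group G] (S : Set G) : SimpleGraph (G × Fin 2) where
  Adj p q :=
    (p.2 = 0 ∧ q.2 = 1 ∧ ∃ s ∈ S, q.1 = s * p.1) ∨ (q.2 = 0 ∧ p.2 = 1 ∧ ∃ s ∈ S, p.1 = s * q.1)
  symm := ⟨fun _ _ h => h.symm⟩
  loopless := ⟨by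
    rintro p (⟨h0, h1, -⟩ | ⟨h0, h1, -⟩) <;> exact absurd (h0.symm.trans h1) (by decide)⟩

/-- A graph is vertex-transitive if its automorphism group is transitive on the vertices. -/
def IsVertexTransitive {V : Type*} (X : SimpleGraph V) : Prop :=
  ∀ u v : V, ∃ φ : X ≃g X, φ u = v

/-- A graph is a Cayley graph if it is isomorphic to `Cay(G, T)` for some group `G` and some
`T ⊆ G` with `1 ∉ T` and `T = T⁻¹`. In `SimpleGraph.mulCayley` the edges are `{g, g * t}`; the
inversion map of `G` is an isomorphism to the graph with edges `{g, t * g}`, so that the choice of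
side does not matter here. -/
def IsCayleyGraph.{u, v} {V : Type u} (X : SimpleGraph V) : Prop :=
  ∃ (G : Type v) (_ : Group G) (T : Set G),
    (1 : G) ∉ T ∧ T⁻¹ = T ∧ Nonempty (X ≃g SimpleGraph.mulCayley T)

namespace DihedralHaar

/-- The rotation `a` in `D_n = ⟨a, b | a ^ n = b ^ 2 = 1, b * a * b = a⁻¹⟩`. -/
def a (n : ℕ) : DihedralGroup n := DihedralGroup.r 1

/-- The reflection `b` in `D_n = ⟨a, b | a ^ n = b ^ 2 = 1, b * a * b = a⁻¹⟩`. -/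
def b (n : ℕ) : DihedralGroup n := DihedralGroup.sr 0

/-- The set `S = {1, a, a³, b, ab, a²b, a⁴b}`. -/
def S (n : ℕ) : Set (DihedralGroup n) :=
  {1, a n, a n ^ 3, b n, a n * b n, a n ^ 2 * b n, a n ^ 4 * b n}

end DihedralHaar

/-! Right translations embed `D_n` in the automorphism group; counts of common neighbours leave
nothing else. Write `S = a^A ∪ a^B b` with `A = {0,1,3}`, `B = {0,1,2,4}`.

For `d = a^k b`, the vertices `(d * h, 0)` and `(h, 0)` have `2|(A + k) ∩ B|` common neighbours: 6
only for `k = 1`, and 4 only for `k = 0, -1`. For a rotation `d ≠ 1` the number is below 4. On the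
other side left multiplication replaces `A` by `-A`, no translate of which lies in `B`, so distinct
vertices share at most 4. Hence the value 6 tells the sides apart (`iso_apply_snd`).

An automorphism thus permutes the 0-side, commuting with left multiplication by `ab` and preserving
the pair of relations given by `b`, `a⁻¹b`. This forces it to commute with all left multiplications
(`isoZero_mul`), so it is a right translation there; the 0-side determines the 1-side
(`iso_eq_one`). -/

section HaarGraph

variable {G : Type*} [Group G] {S : Set G}

@[simp]
theorem haarGraph_adj_zero_one {g h : G} :
    (haarGraph S).Adj (g, 0) (h, 1) ↔ h * g⁻¹ ∈ S := by
  constructor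
  · rintro (⟨-, -, s, hs, h⟩ | ⟨h, -⟩)
    · simp only at h
      simpa [h] using hs
    · simp at h
  · intro hs
    exact Or.inl ⟨rfl, rfl, _, hs, by simp⟩

@[simp]
theorem haarGraph_adj_one_zero {g h : G} :
    (haarGraph S).Adj (g, 1) (h, 0) ↔ g * h⁻¹ ∈ S := by
  rw [SimpleGraph.adj_comm, haarGraph_adj_zero_one]

theorem haarGraph_not_adj_same {g h : G} {i : Fin 2} : ¬ (haarGraph S).Adj (g, i) (h, i) := by
  rintro (⟨h0, h1, -⟩ | ⟨h0, h1, -⟩) <;> exact absurd (h0.symm.trans h1) (by decide)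

/-- Right translation by `g⁻¹`, as an automorphism of a Haar graph. -/
def haarGraphTranslate (S : Set G) : G →* (haarGraph S ≃g haarGraph S) where
  toFun g :=
    { toEquiv := (Equiv.mulRight g⁻¹).prodCongr (Equiv.refl _)
      map_rel_iff' := by
        rintro ⟨x, i⟩ ⟨y, j⟩
        fin_cases i <;> fin_cases j <;> simp [haarGraph_not_adj_same] }
  map_one' := by ext ⟨x, i⟩ <;> simp
  map_mul' g h := by ext ⟨x, i⟩ <;> simp [mul_assoc]

@[simp]
theorem haarGraphTranslate_apply (g x : G) (i : Fin 2) :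
    haarGraphTranslate S g (x, i) = (x * g⁻¹, i) := rfl

theorem ncard_commonNeighbors_iso {V : Type*} {X : SimpleGraph V} (φ : X ≃g X) (u v : V) :
    (X.commonNeighbors (φ u) (φ v)).ncard = (X.commonNeighbors u v).ncard := by
  have : X.commonNeighbors (φ u) (φ v) = φ '' X.commonNeighbors u v := by
    ext w
    obtain ⟨w, rfl⟩ := φ.surjective w
    simp [SimpleGraph.mem_commonNeighbors, φ.map_adj_iff]
  rw [this, Set.ncard_image_of_injective _ φ.injective]

theorem haarGraph_ncard_commonNeighbors_zero (g h : G) :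
    ((haarGraph S).commonNeighbors (g, 0) (h, 0)).ncard =
      {s | s ∈ S ∧ s * (g * h⁻¹) ∈ S}.ncard := by
  rw [← Set.ncard_image_of_injective (f := fun s : G => (s * g, (1 : Fin 2)))]
  · congr 1
    ext ⟨x, i⟩
    fin_cases i
    · simp [SimpleGraph.mem_commonNeighbors, haarGraph_not_adj_same]
    · simp only [SimpleGraph.mem_commonNeighbors, Fin.mk_one, haarGraph_adj_zero_one,
        Set.mem_image, Set.mem_ofPred_eq, Prod.mk.injEq, and_true]
      constructor
      · rintro ⟨h1, h2⟩
        exact ⟨x * g⁻¹, ⟨h1, by simpa [mul_assoc] using h2⟩, by simp⟩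
      · rintro ⟨s, ⟨h1, h2⟩, rfl⟩
        exact ⟨by simpa using h1, by simpa [mul_assoc] using h2⟩
  · intro s t h
    simpa using h

theorem haarGraph_ncard_commonNeighbors_one (g h : G) :
    ((haarGraph S).commonNeighbors (g, 1) (h, 1)).ncard =
      {s | s ∈ S ∧ h * g⁻¹ * s ∈ S}.ncard := by
  rw [← Set.ncard_image_of_injective (f := fun s : G => (s⁻¹ * g, (0 : Fin 2)))]
  · congr 1
    ext ⟨x, i⟩
    fin_cases i
    · simp only [SimpleGraph.mem_commonNeighbors, Fin.zero_eta, haarGraph_adj_one_zero,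
        Set.mem_image, Set.mem_ofPred_eq, Prod.mk.injEq, and_true]
      constructor
      · rintro ⟨h1, h2⟩
        exact ⟨g * x⁻¹, ⟨h1, by simpa [mul_assoc] using h2⟩, by simp⟩
      · rintro ⟨s, ⟨h1, h2⟩, rfl⟩
        exact ⟨by simpa using h1, by simpa [mul_assoc] using h2⟩
    · simp [SimpleGraph.mem_commonNeighbors, haarGraph_not_adj_same]
  · intro s t h
    simpa using h

theorem haarGraph_ncard_commonNeighbors_zero_one (g h : G) :
    ((haarGraph S).commonNeighbors (g, 0) (h, 1)).ncard = 0 := by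
  have : (haarGraph S).commonNeighbors (g, 0) (h, 1) = ∅ := by
    ext ⟨x, i⟩
    fin_cases i <;> simp [SimpleGraph.mem_commonNeighbors, haarGraph_not_adj_same]
  rw [this, Set.ncard_empty]

theorem haarGraph_ncard_commonNeighbors_one_zero (g h : G) :
    ((haarGraph S).commonNeighbors (g, 1) (h, 0)).ncard = 0 := by
  rw [SimpleGraph.commonNeighbors_symm, haarGraph_ncard_commonNeighbors_zero_one]

end HaarGraph

/-- Left multiplications preserve the edges `{g, g * t}` and act transitively. -/
theorem IsCayleyGraph.isVertexTransitive {V : Type*} {X : SimpleGraph V} (h : IsCayleyGraph X) :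
    IsVertexTransitive X := by
  obtain ⟨G, _, T, -, -, ⟨e⟩⟩ := h
  intro u v
  let τ : SimpleGraph.mulCayley T ≃g SimpleGraph.mulCayley T :=
    { toEquiv := Equiv.mulLeft (e v * (e u)⁻¹)
      map_rel_iff' := by
        intro x y
        simp [SimpleGraph.mulCayley_adj, mul_assoc] }
  refine ⟨(e.trans τ).trans e.symm, ?_⟩
  simp [τ]

/-! ### Intersections of `S` with its translates -/

namespace DihedralHaar

open DihedralGroup

variable {n : ℕ}

theorem r_mem_S (i : ZMod n) :
    r i ∈ S n ↔ i = ((0 : ℤ) : ZMod n) ∨ i = ((1 : ℤ) : ZMod n) ∨ i = ((3 : ℤ) : ZMod n) := by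
  simp [S, a, b, one_def, -r_zero]

theorem sr_mem_S (i : ZMod n) :
    sr i ∈ S n ↔ i = ((0 : ℤ) : ZMod n) ∨ i = ((-1 : ℤ) : ZMod n) ∨ i = ((-2 : ℤ) : ZMod n) ∨
      i = ((-4 : ℤ) : ZMod n) := by
  simp [S, a, b, one_def, -r_zero]

/-- Turns congruences into linear arithmetic, so that `omega` settles the counts for all `n > 7` at
once. The bound 7 is the largest shift that occurs, from `-4 - 3`. -/
theorem intCast_eq_iff (hn : 7 < n) (c : ℤ) (h₁ : -7 ≤ c) (h₂ : c ≤ 7) (k : ZMod n) :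
    k = (c : ZMod n) ↔ (k.val : ℤ) = c ∨ (k.val : ℤ) = c + n := by
  have : NeZero n := ⟨by omega⟩
  have hk := k.val_lt
  have : k = ((k.val : ℤ) : ZMod n) := by simp
  rw [this, ZMod.intCast_eq_intCast_iff_dvd_sub, ← this]
  constructor
  · rintro ⟨q, hq⟩
    have h1 : q < 1 := by
      by_contra! h
      nlinarith
    have h2 : -2 < q := by
      by_contra! h
      nlinarith
    obtain rfl | rfl : q = 0 ∨ q = -1 := by omega
    · left; omega
    · right; omega
  · rintro (h | h)
    · exact ⟨0, by omega⟩
    · exact ⟨-1, by omega⟩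

theorem add_intCast_eq_iff (hn : 7 < n) (i j : ℤ) (h₁ : -7 ≤ j - i) (h₂ : j - i ≤ 7)
    (k : ZMod n) :
    (i : ZMod n) + k = (j : ZMod n) ↔ (k.val : ℤ) = j - i ∨ (k.val : ℤ) = j - i + n := by
  rw [← intCast_eq_iff hn _ h₁ h₂, ← eq_sub_iff_add_eq']
  push_cast
  rfl

theorem sub_intCast_eq_iff (hn : 7 < n) (i j : ℤ) (h₁ : -7 ≤ j + i) (h₂ : j + i ≤ 7)
    (k : ZMod n) :
    k - (i : ZMod n) = (j : ZMod n) ↔ (k.val : ℤ) = j + i ∨ (k.val : ℤ) = j + i + n := by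
  rw [← intCast_eq_iff hn _ h₁ h₂, sub_eq_iff_eq_add]
  push_cast
  rfl

theorem intCast_sub_eq_iff (hn : 7 < n) (i j : ℤ) (h₁ : -7 ≤ i - j) (h₂ : i - j ≤ 7)
    (k : ZMod n) :
    (i : ZMod n) - k = (j : ZMod n) ↔ (k.val : ℤ) = i - j ∨ (k.val : ℤ) = i - j + n := by
  rw [← intCast_eq_iff hn _ h₁ h₂, sub_eq_iff_eq_add', ← sub_eq_iff_eq_add, eq_comm]
  push_cast
  rfl

theorem intCast_eq_intCast_iff (hn : 7 < n) (i j : ℤ) (h₁ : -7 ≤ i - j) (h₂ : i - j ≤ 7) :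
    (i : ZMod n) = (j : ZMod n) ↔ i = j := by
  have := intCast_sub_eq_iff hn i j h₁ h₂ 0
  rw [sub_zero, ZMod.val_zero] at this
  rw [this]
  omega

open Classical in
theorem ncard_sep_S (hn : 7 < n) (p : DihedralGroup n → Prop) :
    {s | s ∈ S n ∧ p s}.ncard =
      (if p (r ((0 : ℤ) : ZMod n)) then 1 else 0) + (if p (r ((1 : ℤ) : ZMod n)) then 1 else 0) +
      (if p (r ((3 : ℤ) : ZMod n)) then 1 else 0) + (if p (sr ((0 : ℤ) : ZMod n)) then 1 else 0) +
      (if p (sr ((-1 : ℤ) : ZMod n)) then 1 else 0) +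
      (if p (sr ((-2 : ℤ) : ZMod n)) then 1 else 0) +
      (if p (sr ((-4 : ℤ) : ZMod n)) then 1 else 0) := by
  let F : Finset (DihedralGroup n) :=
    {r ((0 : ℤ) : ZMod n), r ((1 : ℤ) : ZMod n), r ((3 : ℤ) : ZMod n), sr ((0 : ℤ) : ZMod n),
      sr ((-1 : ℤ) : ZMod n), sr ((-2 : ℤ) : ZMod n), sr ((-4 : ℤ) : ZMod n)}
  have hF : {s | s ∈ S n ∧ p s} = (F.filter p : Set (DihedralGroup n)) := by
    ext (i | i)
    · simp only [F, Set.mem_ofPred_eq, r_mem_S, Finset.coe_filter, Finset.mem_insert,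
        Finset.mem_singleton, r.injEq, reduceCtorEq, or_false]
    · simp only [F, Set.mem_ofPred_eq, sr_mem_S, Finset.coe_filter, Finset.mem_insert,
        Finset.mem_singleton, sr.injEq, reduceCtorEq, false_or]
  rw [hF, Set.ncard_coe_finset, Finset.card_filter]
  simp only [F]
  have e := intCast_eq_intCast_iff hn
  repeat rw [Finset.sum_insert (by
    simp only [Finset.mem_insert, Finset.mem_singleton, r.injEq, sr.injEq, reduceCtorEq, or_false]
    try rw [e _ _ (by norm_num) (by norm_num)]
    try rw [e _ _ (by norm_num) (by norm_num)]
    try rw [e _ _ (by norm_num) (by norm_num)]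
    norm_num)]
  rw [Finset.sum_singleton]
  ring

theorem ncard_mul_right_r (hn : 7 < n) (k : ZMod n) (hk : k ≠ 0) :
    {s | s ∈ S n ∧ s * r k ∈ S n}.ncard < 4 := by
  have : NeZero n := ⟨by omega⟩
  have hv := k.val_lt
  rw [← ZMod.val_ne_zero] at hk
  classical
  rw [ncard_sep_S hn]
  simp (disch := norm_num) only [r_mul_r, sr_mul_r, r_mem_S, sr_mem_S, add_intCast_eq_iff hn]
  split_ifs <;> omega

theorem ncard_mul_right_sr (hn : 7 < n) (k : ZMod n) :
    ({s | s ∈ S n ∧ s * sr k ∈ S n}.ncard = 6 ↔ k = ((-1 : ℤ) : ZMod n)) ∧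
    ({s | s ∈ S n ∧ s * sr k ∈ S n}.ncard = 4 ↔
      k = ((0 : ℤ) : ZMod n) ∨ k = ((1 : ℤ) : ZMod n)) := by
  have : NeZero n := ⟨by omega⟩
  have hv := k.val_lt
  classical
  rw [ncard_sep_S hn]
  rw [intCast_eq_iff hn (-1) (by norm_num) (by norm_num) k,
    intCast_eq_iff hn 0 (by norm_num) (by norm_num) k,
    intCast_eq_iff hn 1 (by norm_num) (by norm_num) k]
  simp (disch := norm_num) only [r_mul_sr, sr_mul_sr, r_mem_S, sr_mem_S, sub_intCast_eq_iff hn]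
  split_ifs <;> refine ⟨⟨fun h => ?_, fun h => ?_⟩, ⟨fun h => ?_, fun h => ?_⟩⟩ <;>
    first | omega | (simp only [false_or] at h ⊢; omega)

theorem ncard_mul_left_r (hn : 7 < n) (k : ZMod n) (hk : k ≠ 0) :
    {s | s ∈ S n ∧ r k * s ∈ S n}.ncard < 4 := by
  have : NeZero n := ⟨by omega⟩
  have hv := k.val_lt
  rw [← ZMod.val_ne_zero] at hk
  classical
  rw [ncard_sep_S hn]
  simp (disch := norm_num) only [r_mul_r, r_mul_sr, r_mem_S, sr_mem_S, add_comm k,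
    add_intCast_eq_iff hn, intCast_sub_eq_iff hn]
  split_ifs <;> omega

theorem ncard_mul_left_sr (hn : 7 < n) (k : ZMod n) :
    {s | s ∈ S n ∧ sr k * s ∈ S n}.ncard ≤ 4 := by
  have : NeZero n := ⟨by omega⟩
  have hv := k.val_lt
  classical
  rw [ncard_sep_S hn]
  simp (disch := norm_num) only [sr_mul_r, sr_mul_sr, r_mem_S, sr_mem_S, add_comm k,
    add_intCast_eq_iff hn, intCast_sub_eq_iff hn]
  split_ifs <;> omega

theorem ncard_S (hn : 7 < n) : {s | s ∈ S n ∧ s ∈ S n}.ncard = 7 := by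
  classical
  rw [ncard_sep_S hn]
  simp only [r_mem_S, sr_mem_S, true_or, or_true, if_true]

theorem ncard_mul_right_eq_six_iff (hn : 7 < n) (d : DihedralGroup n) :
    {s | s ∈ S n ∧ s * d ∈ S n}.ncard = 6 ↔ d = sr (-1) := by
  rcases d with k | k
  · by_cases hk : k = 0
    · subst hk
      rw [r_zero]
      simp only [mul_one, ncard_S hn]
      simp [one_def, -r_zero]
    · have := ncard_mul_right_r hn k hk
      simp only [reduceCtorEq, iff_false]
      omega
  · rw [(ncard_mul_right_sr hn k).1]
    simp

theorem ncard_mul_right_eq_four_iff (hn : 7 < n) (d : DihedralGroup n) :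
    {s | s ∈ S n ∧ s * d ∈ S n}.ncard = 4 ↔ d = sr 0 ∨ d = sr 1 := by
  rcases d with k | k
  · by_cases hk : k = 0
    · subst hk
      rw [r_zero]
      simp only [mul_one, ncard_S hn]
      simp [one_def, -r_zero]
    · have := ncard_mul_right_r hn k hk
      simp only [reduceCtorEq, or_self, iff_false]
      omega
  · rw [(ncard_mul_right_sr hn k).2]
    simp

theorem ncard_mul_left (hn : 7 < n) (d : DihedralGroup n) :
    d = 1 ∨ {s | s ∈ S n ∧ d * s ∈ S n}.ncard ≤ 4 := by
  rcases d with k | k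
  · by_cases hk : k = 0
    · left; rw [hk, r_zero]
    · exact .inr (ncard_mul_left_r hn k hk).le
  · exact .inr (ncard_mul_left_sr hn k)

/-- `Γ n` is the Haar graph of the dihedral group with respect to `S n`. -/
abbrev Γ (n : ℕ) : SimpleGraph (DihedralGroup n × Fin 2) := haarGraph (S n)

/-! ### Rigidity of automorphisms -/

theorem eq_sr_neg_one_iff (hn : 7 < n) (g h : DihedralGroup n) :
    ((Γ n).commonNeighbors (g, 0) (h, 0)).ncard = 6 ↔ h = sr (-1) * g := by
  rw [haarGraph_ncard_commonNeighbors_zero, ncard_mul_right_eq_six_iff hn, mul_inv_eq_iff_eq_mul]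
  constructor <;> rintro rfl <;> simp [← mul_assoc]

theorem eq_sr_zero_or_one_iff (hn : 7 < n) (g h : DihedralGroup n) :
    ((Γ n).commonNeighbors (g, 0) (h, 0)).ncard = 4 ↔ h = sr 0 * g ∨ h = sr 1 * g := by
  rw [haarGraph_ncard_commonNeighbors_zero, ncard_mul_right_eq_four_iff hn,
    mul_inv_eq_iff_eq_mul, mul_inv_eq_iff_eq_mul]
  constructor <;> rintro (rfl | rfl) <;> simp [← mul_assoc, -r_zero, ← one_def]

theorem ncard_commonNeighbors_one_le (hn : 7 < n) {g h : DihedralGroup n} (hgh : g ≠ h) :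
    ((Γ n).commonNeighbors (g, 1) (h, 1)).ncard ≤ 4 := by
  rw [haarGraph_ncard_commonNeighbors_one]
  refine (ncard_mul_left hn _).resolve_left fun h1 => hgh ?_
  exact (mul_inv_eq_one.1 h1).symm

theorem ncard_commonNeighbors_one_self (hn : 7 < n) (g : DihedralGroup n) :
    ((Γ n).commonNeighbors (g, 1) (g, 1)).ncard = 7 := by
  rw [haarGraph_ncard_commonNeighbors_one]
  simp only [mul_inv_cancel, one_mul, ncard_S hn]

/-- Each `(g, 0)` has a partner with exactly 6 common neighbours, which no vertex of the 1-side has.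
-/
theorem iso_apply_zero_snd (hn : 7 < n) (φ : Γ n ≃g Γ n) (g : DihedralGroup n) :
    (φ (g, 0)).2 = 0 := by
  have h6 := (eq_sr_neg_one_iff hn g (sr (-1) * g)).2 rfl
  have hne : φ (g, 0) ≠ φ (sr (-1) * g, 0) := by
    intro h
    have := congrArg Prod.fst (φ.injective h)
    simp [one_def, -r_zero] at this
  rw [← ncard_commonNeighbors_iso φ] at h6
  generalize φ (g, 0) = u at h6 hne
  generalize φ (sr (-1) * g, 0) = v at h6 hne
  obtain ⟨x, i⟩ := u
  obtain ⟨y, j⟩ := v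
  fin_cases i
  · rfl
  · fin_cases j
    · have := haarGraph_ncard_commonNeighbors_one_zero (S := S n) x y
      exact absurd (this.symm.trans h6) (by norm_num)
    · have := ncard_commonNeighbors_one_le hn (g := x) (h := y) (by
        rintro rfl; exact hne rfl)
      exact absurd (h6.symm.trans_le this) (by norm_num)

theorem iso_apply_snd (hn : 7 < n) (φ : Γ n ≃g Γ n) (v : DihedralGroup n × Fin 2) :
    (φ v).2 = v.2 := by
  obtain ⟨g, i⟩ := v
  fin_cases i
  · exact iso_apply_zero_snd hn φ g
  · have h := iso_apply_zero_snd hn φ.symm (φ (g, 1)).1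
    by_contra hne
    change ¬ (φ (g, 1)).2 = 1 at hne
    have h0 : (φ (g, 1)).2 = 0 := by omega
    have : ((φ (g, 1)).1, (0 : Fin 2)) = φ (g, 1) := Prod.ext rfl h0.symm
    rw [this] at h
    simp at h

/-- The permutation of the group induced by a graph automorphism on the vertices `(g, 0)`. -/
def isoZero (φ : Γ n ≃g Γ n) (g : DihedralGroup n) : DihedralGroup n := (φ (g, 0)).1

theorem iso_apply_zero (hn : 7 < n) (φ : Γ n ≃g Γ n) (g : DihedralGroup n) :
    φ (g, 0) = (isoZero φ g, 0) :=
  Prod.ext rfl (iso_apply_zero_snd hn φ g)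

theorem isoZero_sr_neg_one_mul (hn : 7 < n) (φ : Γ n ≃g Γ n) (g : DihedralGroup n) :
    isoZero φ (sr (-1) * g) = sr (-1) * isoZero φ g := by
  rw [← eq_sr_neg_one_iff hn, ← iso_apply_zero hn, ← iso_apply_zero hn,
    ncard_commonNeighbors_iso, eq_sr_neg_one_iff hn]

/-- Composing the 6-relation `sr (-1)` with the 4-relations `sr 0`, `sr 1` gives the rotations `r
1`, `r 2`, which might still be interchanged. -/
theorem isoZero_r_mul (hn : 7 < n) (φ : Γ n ≃g Γ n) (g : DihedralGroup n) (i : ZMod n)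
    (hi : i = 1 ∨ i = 2) :
    isoZero φ (r i * g) = r 1 * isoZero φ g ∨ isoZero φ (r i * g) = r 2 * isoZero φ g := by
  have key : isoZero φ (sr (i - 1) * g) = sr 0 * isoZero φ g ∨
      isoZero φ (sr (i - 1) * g) = sr 1 * isoZero φ g := by
    rw [← eq_sr_zero_or_one_iff hn, ← iso_apply_zero hn, ← iso_apply_zero hn,
      ncard_commonNeighbors_iso, eq_sr_zero_or_one_iff hn]
    rcases hi with rfl | rfl
    · left; simp
    · right; norm_num
  have e : r i * g = sr (-1) * (sr (i - 1) * g) := by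
    rw [← mul_assoc, sr_mul_sr]; congr 2; ring
  rw [e, isoZero_sr_neg_one_mul hn]
  rcases key with h | h <;> rw [h, ← mul_assoc, sr_mul_sr]
  · left; congr 2; ring
  · right; congr 2; ring

/-- If the step `r 1` from `g` became `r 2`, a second step would send `r 2 * g` to `r 3` or `r 4`
times the image of `g`, whereas only `r 1` or `r 2` is allowed. -/
theorem isoZero_r_one_mul (hn : 7 < n) (φ : Γ n ≃g Γ n) (g : DihedralGroup n) :
    isoZero φ (r 1 * g) = r 1 * isoZero φ g := by
  refine (isoZero_r_mul hn φ g 1 (.inl rfl)).resolve_right fun h1 => ?_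
  have e := intCast_eq_intCast_iff hn
  have e13 := e 1 3 (by norm_num) (by norm_num)
  have e14 := e 1 4 (by norm_num) (by norm_num)
  have e23 := e 2 3 (by norm_num) (by norm_num)
  have e24 := e 2 4 (by norm_num) (by norm_num)
  have h2 := isoZero_r_mul hn φ g 2 (.inr rfl)
  have h3 := isoZero_r_mul hn φ (r 1 * g) 1 (.inl rfl)
  rw [← mul_assoc, r_mul_r, one_add_one_eq_two, h1, ← mul_assoc, ← mul_assoc, r_mul_r,
    r_mul_r] at h3
  norm_num at e13 e14 e23 e24 h3
  rcases h2 with h2 | h2 <;> rw [h2] at h3 <;>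
    simp only [mul_left_inj, r.injEq] at h3 <;> tauto

theorem isoZero_r_mul_all (hn : 7 < n) (φ : Γ n ≃g Γ n) (k : ZMod n) (g : DihedralGroup n) :
    isoZero φ (r k * g) = r k * isoZero φ g := by
  have : NeZero n := ⟨by omega⟩
  have key : ∀ m : ℕ, isoZero φ (r (m : ZMod n) * g) = r (m : ZMod n) * isoZero φ g := by
    intro m
    induction m with
    | zero => simp
    | succ m ih =>
      have : r ((m + 1 : ℕ) : ZMod n) = r 1 * r (m : ZMod n) := by
        rw [r_mul_r]; push_cast; congr 1; ring
      rw [this, mul_assoc, isoZero_r_one_mul hn, ih, mul_assoc]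
  simpa using key k.val

theorem isoZero_mul (hn : 7 < n) (φ : Γ n ≃g Γ n) (x g : DihedralGroup n) :
    isoZero φ (x * g) = x * isoZero φ g := by
  rcases x with k | k
  · exact isoZero_r_mul_all hn φ k g
  · have : sr k = sr (-1) * r (k + 1) := by rw [sr_mul_r]; congr 1; ring
    rw [this, mul_assoc, isoZero_sr_neg_one_mul hn, isoZero_r_mul_all hn, mul_assoc]

/-- A vertex `(g, 1)` and its image have the same 7 neighbours, but distinct vertices of the 1-side
share at most 4. -/
theorem iso_eq_one (hn : 7 < n) (φ : Γ n ≃g Γ n) (h : ∀ g, φ (g, 0) = (g, 0)) : φ = 1 := by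
  ext1 ⟨g, i⟩
  fin_cases i
  · exact h g
  · have h1 : φ (g, 1) = ((φ (g, 1)).1, 1) := Prod.ext rfl (iso_apply_snd hn φ _)
    change φ (g, 1) = (g, 1)
    by_contra hne
    have hle := ncard_commonNeighbors_one_le hn (g := g) (h := (φ (g, 1)).1) (by
      intro h'
      rw [← h'] at h1
      exact hne h1)
    have : (Γ n).commonNeighbors (g, 1) ((φ (g, 1)).1, 1) =
        (Γ n).commonNeighbors (g, 1) (g, 1) := by
      rw [← h1]
      ext ⟨x, j⟩
      fin_cases j
      · have := φ.map_adj_iff (v := (g, 1)) (w := (x, 0))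
        rw [h x] at this
        simp only [SimpleGraph.mem_commonNeighbors, Fin.zero_eta, this]
      · simp [SimpleGraph.mem_commonNeighbors, haarGraph_not_adj_same]
    rw [this, ncard_commonNeighbors_one_self hn] at hle
    omega

/-! ### The automorphism group and its orbits -/

theorem haarGraphTranslate_bijective (hn : 7 < n) :
    Function.Bijective (haarGraphTranslate (S n)) := by
  constructor
  · intro g h hgh
    have := congrArg (fun φ : Γ n ≃g Γ n => (φ (1, 0)).1) hgh
    simpa using this
  · intro φ
    -- On the 0-side `φ` is right multiplication by `isoZero φ 1`; the inverse offsets the one in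
    -- `haarGraphTranslate`.
    refine ⟨(isoZero φ 1)⁻¹, ?_⟩
    rw [← mul_inv_eq_one]
    have : (haarGraphTranslate (S n) (isoZero φ 1)⁻¹)⁻¹ * φ = 1 := by
      apply iso_eq_one hn
      intro g
      rw [← map_inv, inv_inv, RelIso.mul_apply, iso_apply_zero hn, haarGraphTranslate_apply]
      have := isoZero_mul hn φ g 1
      rw [mul_one] at this
      simp [this]
    rw [inv_mul_eq_one.1 this, mul_inv_cancel]

theorem not_isVertexTransitive (hn : 7 < n) : ¬ IsVertexTransitive (Γ n) := by
  intro h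
  obtain ⟨φ, hφ⟩ := h (1, 0) (1, 1)
  have := iso_apply_snd hn φ (1, 0)
  rw [hφ] at this
  simp at this

theorem exists_iso_iff (hn : 7 < n) (u v : DihedralGroup n × Fin 2) :
    (∃ φ : Γ n ≃g Γ n, φ u = v) ↔ u.2 = v.2 := by
  constructor
  · rintro ⟨φ, rfl⟩
    exact (iso_apply_snd hn φ u).symm
  · obtain ⟨x, i⟩ := u
    obtain ⟨y, j⟩ := v
    rintro rfl
    exact ⟨haarGraphTranslate (S n) (y⁻¹ * x), by
      rw [haarGraphTranslate_apply]; simp⟩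

theorem card_orbits (hn : 7 < n) :
    Nat.card (MulAction.orbitRel.Quotient (Γ n ≃g Γ n) (DihedralGroup n × Fin 2)) = 2 := by
  have hrel : ∀ u v : DihedralGroup n × Fin 2,
      MulAction.orbitRel (Γ n ≃g Γ n) _ u v ↔ u.2 = v.2 := by
    intro u v
    rw [MulAction.orbitRel_apply, MulAction.mem_orbit_iff, eq_comm]
    exact exists_iso_iff hn v u
  let f : MulAction.orbitRel.Quotient (Γ n ≃g Γ n) (DihedralGroup n × Fin 2) → Fin 2 :=
    Quotient.lift Prod.snd fun u v h => (hrel u v).1 h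
  have hf : Function.Bijective f := by
    constructor
    · intro p q
      induction p using Quotient.inductionOn
      induction q using Quotient.inductionOn
      intro h
      exact Quotient.sound ((hrel _ _).2 h)
    · intro i
      exact ⟨Quotient.mk _ (1, i), rfl⟩
  rw [Nat.card_eq_of_bijective f hf, Nat.card_eq_fintype_card, Fintype.card_fin]

end DihedralHaar

theorem proposition3p5 (n : ℕ) (hn : 7 < n) :
    Nonempty ((haarGraph (DihedralHaar.S n) ≃g haarGraph (DihedralHaar.S n)) ≃* DihedralGroup n) ∧
    Nat.card (MulAction.orbitRel.Quotient
      (haarGraph (DihedralHaar.S n) ≃g haarGraph (DihedralHaar.S n))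
      (DihedralGroup n × Fin 2)) = 2 ∧
    ¬ IsVertexTransitive (haarGraph (DihedralHaar.S n)) ∧
    ¬ IsCayleyGraph.{0, w} (haarGraph (DihedralHaar.S n)) :=
  ⟨⟨(MulEquiv.ofBijective _ (DihedralHaar.haarGraphTranslate_bijective hn)).symm⟩,
    DihedralHaar.card_orbits hn, DihedralHaar.not_isVertexTransitive hn,
    fun h => DihedralHaar.not_isVertexTransitive hn h.isVertexTransitive⟩
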